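/- Let $G$ be a finite group of order $v$ and let $D\subseteq G$ be a regular $(v,k,\lambda,\mu)$-partial difference set, that is: $|D|=k$, $1\notin D$, $D=\{d^{-1}:d\in D\}$, and every nonidentity $x\in G$ can be written as $x=gh^{-1}$ with $g,h\in D$ in exactly $\lambda$ ways if $x\in D$ and in exactly $\mu$ ways if $x\notin D$. Assume $\mu>0$ and that $\sqrt\Delta$ is an integer, where $\Delta=(\lambda-\mu)^2+4(k-\mu)$. Put $$\theta_1=\tfrac12(\lambda-\mu+\sqrt\Delta),\qquad \theta_2=\tfrac12(\lambda-\mu-\sqrt\Delta).$$ Let $\mu=\mu_1\mu_2$ be any factorization into positive integers such that $v_1=(k-\theta_1)/\mu_1$ and $v_2=(k-\theta_2)/\mu_2$ are positive integers with $v=v_1v_2$. For $i=1,2$ let $\pi_i$ be the largest positive divisor of $v_i$ with $\gcd(\sqrt\Delta,\pi_i)=1$, and let $\Pi_i$ be the set of primes dividing $\pi_i$. Let $\mathcal L=\operatorname{Hom}(G,\mathbb C^\times)$ be the group of linear characters of $G$, and let $\{\alpha,\beta\}=\{1,2\}$. Suppose that $p$ is a prime dividing $|G|$ with $p\nmid\sqrt\Delta$,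 that $p\in\Pi_\alpha$, and that $p$ divides $|\mathcal L|$. Let $P$ be a Sylow $p$-subgroup of $G$. Then $$\gcd(|N_G(P)|,\pi_\beta)=1.$$ If moreover $G$ is solvable, then $\pi_\beta\equiv 1\pmod p$. -/

import Mathlib

/-- `D` is a `(v, k, lam, mu)`-partial difference set in the group `G`: `G` has order `v`, `D` has
size `k`, and every nonidentity `x` has exactly `lam` (if `x ∈ D`) or `mu` (if `x ∉ D`)
representations `x = g * h⁻¹` with `g, h ∈ D` (automatically `g ≠ h`). -/
structure IsPDS {G : Type*} [Group G] (D : Set G) (v k lam mu : ℕ) : Prop where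
  card_group : Nat.card G = v
  card_set : D.ncard = k
  count_mem : ∀ x : G, x ≠ 1 → x ∈ D →
    {q : G × G | q.1 ∈ D ∧ q.2 ∈ D ∧ q.1 * q.2⁻¹ = x}.ncard = lam
  count_notMem : ∀ x : G, x ≠ 1 → x ∉ D →
    {q : G × G | q.1 ∈ D ∧ q.2 ∈ D ∧ q.1 * q.2⁻¹ = x}.ncard = mu

/-- A regular partial difference set: inverse closed and not containing the identity. -/
structure IsRegularPDS {G : Type*} [Group G] (D : Set G) (v k lam mu : ℕ) : Prop
    extends IsPDS D v k lam mu where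
  inv_mem : ∀ x ∈ D, x⁻¹ ∈ D
  one_notMem : (1 : G) ∉ D

/-- The discriminant `Δ = (lam - mu)² + 4 (k - mu)`. -/
def pdsDisc (k lam mu : ℕ) : ℝ := ((lam : ℝ) - mu) ^ 2 + 4 * ((k : ℝ) - mu)

/-- The two eigenvalues `(lam - mu ± √Δ) / 2`; index `0` is the one with the plus sign. -/
noncomputable def pdsTheta (k lam mu : ℕ) : Fin 2 → ℝ :=
  ![((lam : ℝ) - mu + Real.sqrt (pdsDisc k lam mu)) / 2,
    ((lam : ℝ) - mu - Real.sqrt (pdsDisc k lam mu)) / 2]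

/-- A factorization `mu = m 0 * m 1` such that the quotients `w i = (k - θ i) / m i` are
integers with `v = w 0 * w 1`. -/
structure IsPDSFactorization (v k lam mu : ℕ) (m w : Fin 2 → ℕ) : Prop where
  mu_eq : mu = m 0 * m 1
  quot_eq : ∀ i, (w i : ℝ) = ((k : ℝ) - pdsTheta k lam mu i) / (m i : ℝ)
  v_eq : v = w 0 * w 1

/-- The largest divisor of `n` that is coprime to `s` (for `n ≠ 0`). -/
def coprimePart (s n : ℕ) : ℕ := (n.divisors.filter (fun d => Nat.gcd s d = 1)).sup id

theorem isGreatest_coprimePart (s n : ℕ) (hn : n ≠ 0) :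
    IsGreatest {d : ℕ | d ∣ n ∧ Nat.gcd s d = 1} (coprimePart s n) := by
  have hne : (n.divisors.filter (fun d => Nat.gcd s d = 1)).Nonempty :=
    ⟨1, by simp [hn]⟩
  constructor
  · obtain ⟨d, hd, he⟩ := Finset.exists_mem_eq_sup _ hne (id : ℕ → ℕ)
    have h2 := Finset.mem_filter.1 hd
    have h3 : coprimePart s n = d := he
    rw [h3]
    exact ⟨(Nat.mem_divisors.1 h2.1).1, h2.2⟩
  · rintro d ⟨hd, hs⟩
    exact Finset.le_sup (f := (id : ℕ → ℕ))
      (Finset.mem_filter.2 ⟨Nat.mem_divisors.2 ⟨hd, hn⟩, hs⟩)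

/-! Convolution by `D` has eigenvalues k, t = θ_α and t' = θ_β. The projection onto the
t'-eigenspace becomes integral after scaling by c = w_β (t' - t) = ±w_β s. Since p divides w_α but
not s, and m_α w_α - m_β w_β = ±s, p does not divide c.

A linear character χ of order p is congruent to 1 modulo a prime of the algebraic integers above p,
so twisting the projection by χ gives a congruent idempotent. Congruent idempotents are intertwined
by an invertible matrix commuting with right translations (`trace_mul_eq_of_idempotent_congr`).
Traces against translation by g then give S = χ(g) S for the class sum S at g, whence S = 0 if χ(g)
≠ 1 (`sum_conj_eq_zero`). Equivalently, exactly m_α w_α elements conjugate g into `D`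
(`IsRegularPDS.ncard_conj_mem`).

If a prime q divides both π_β and |N_G(P)|, some x of order q in N_G(P) centralizes such a g in P
(`exists_mem_sylow_commute`) and acts freely on those elements. So q divides m_α w_α as well as w_β,
hence s: a contradiction.

For solvable G, π_β is a Hall divisor of v. In a Hall subgroup of order |P| π_β a Sylow p-subgroup
is its own normalizer, so there are π_β of them, and Sylow's congruence applies. -/

/-! ### Congruent idempotents and traces -/

/-- Two idempotents (up to the scalar `c`) that agree modulo a prime not containing `c` have the
same trace against every matrix commuting with both. -/
theorem trace_mul_eq_of_idempotent_congr {n R K : Type*} [Fintype n] [DecidableEq n]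
    [CommRing R] [IsDomain R] [Field K] (φ : R →+* K) (c : R) (E F ρ : Matrix n n R)
    (hE : E * E = c • E) (hF : F * F = c • F) (hEF : φ.mapMatrix E = φ.mapMatrix F)
    (hc : φ c ≠ 0) (hEρ : E * ρ = ρ * E) (hFρ : F * ρ = ρ * F) :
    (E * ρ).trace = (F * ρ).trace := by
  -- The standard intertwiner of two idempotents: `E * U = U * F`, and `U` reduces to the scalar `c
  -- ^ 2` where `E` and `F` agree, so its determinant is nonzero.
  set U : Matrix n n R := E * F + (c • 1 - E) * (c • 1 - F) with hU
  have hEU : E * U = c • (E * F) := by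
    have : E * (c • 1 - E) = 0 := by rw [mul_sub, hE]; simp
    rw [hU, mul_add, ← mul_assoc, ← mul_assoc, this, hE]
    simp
  have hUF : U * F = c • (E * F) := by
    have : (c • 1 - F) * F = 0 := by rw [sub_mul, hF]; simp
    rw [hU, add_mul, mul_assoc, mul_assoc, this, hF]
    simp
  have hUρ : ρ * U = U * ρ := by
    have h1 : Commute ρ E := hEρ.symm
    have h2 : Commute ρ F := hFρ.symm
    have h3 : Commute ρ (c • (1 : Matrix n n R)) := (Commute.one_right ρ).smul_right c
    exact ((h1.mul_right h2).add_right ((h3.sub_right h1).mul_right (h3.sub_right h2))).eq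
  have hφU : φ.mapMatrix U = (φ c * φ c) • (1 : Matrix n n K) := by
    have h1 : φ.mapMatrix (c • (1 : Matrix n n R)) = φ c • 1 := by
      ext i j
      by_cases h : i = j <;> simp [h]
    have h2 : φ.mapMatrix F * φ.mapMatrix F = φ c • φ.mapMatrix F := by
      rw [← map_mul, hF]
      ext i j
      simp
    rw [hU, map_add, map_mul, map_mul, map_sub, map_sub, h1, hEF, sub_mul, mul_sub, mul_sub, h2]
    simp [smul_smul]
  have hdet : U.det ≠ 0 := by
    intro h
    have h1 : (φ.mapMatrix U).det = 0 := by rw [← RingHom.map_det, h, map_zero]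
    rw [hφU, Matrix.det_smul, Matrix.det_one, mul_one] at h1
    exact mul_ne_zero hc hc (eq_zero_of_pow_eq_zero h1)
  refine mul_left_cancel₀ hdet ?_
  calc U.det * (E * ρ).trace = (E * (U * U.adjugate) * ρ).trace := by
        rw [Matrix.mul_adjugate]; simp
    _ = ((U * F) * (U.adjugate * ρ)).trace := by rw [hUF, ← hEU]; simp only [mul_assoc]
    _ = (F * (U.adjugate * ρ) * U).trace := by
        rw [mul_assoc U, Matrix.trace_mul_comm]
    _ = (F * (U.adjugate * U) * ρ).trace := by simp only [mul_assoc, hUρ]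
    _ = U.det * (F * ρ).trace := by rw [Matrix.adjugate_mul]; simp

theorem exists_isMaximal_integralClosure_int_mem_iff_dvd (p : ℕ) (hp : p.Prime) :
    ∃ (Q : Ideal (integralClosure ℤ ℂ)) (_ : Q.IsMaximal),
      ∀ a : ℤ, Ideal.Quotient.mk Q (a : integralClosure ℤ ℂ) = 0 ↔ (p : ℤ) ∣ a := by
  have hp' : Prime (p : ℤ) := Nat.prime_iff_prime_int.1 hp
  have hmax : (Ideal.span {(p : ℤ)}).IsMaximal :=
    PrincipalIdealRing.isMaximal_of_irreducible hp'.irreducible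
  have hker : RingHom.ker (algebraMap ℤ (integralClosure ℤ ℂ)) ≤ Ideal.span {(p : ℤ)} := by
    intro a ha
    have : a = 0 := by simpa [RingHom.mem_ker] using ha
    simp [this]
  obtain ⟨Q, hQ, hQp⟩ := Ideal.exists_ideal_over_maximal_of_isIntegral
    (S := integralClosure ℤ ℂ) (Ideal.span {(p : ℤ)}) hker
  refine ⟨Q, hQ, fun a => ?_⟩
  rw [Ideal.Quotient.eq_zero_iff_mem, ← Ideal.mem_span_singleton, ← hQp, Ideal.mem_comap]
  simp

/-! ### Class sums of idempotents in the group algebra -/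

/-- The matrix of left convolution by `f` on a group. -/
def convMatrix {G R : Type*} [Group G] (f : G → R) : Matrix G G R := Matrix.of fun x y => f (x * y⁻¹)

/-- The permutation matrix of right translation by `g`. -/
def rightTranslationMatrix {G : Type*} (R : Type*) [Group G] [DecidableEq G] [Zero R] [One R]
    (g : G) : Matrix G G R :=
  Matrix.of fun y x => if x = y * g then 1 else 0

theorem convMatrix_mul_rightTranslationMatrix {G R : Type*} [Group G] [Fintype G] [DecidableEq G]
    [CommRing R] (f : G → R) (g : G) :
    convMatrix f * rightTranslationMatrix R g = Matrix.of fun x y => f (x * g * y⁻¹) := by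
  ext x y
  have : ∀ z : G, y = z * g ↔ z = y * g⁻¹ := fun z => by
    rw [eq_mul_inv_iff_mul_eq, eq_comm]
  simp [convMatrix, rightTranslationMatrix, Matrix.mul_apply, this, mul_assoc]

theorem rightTranslationMatrix_mul_convMatrix {G R : Type*} [Group G] [Fintype G] [DecidableEq G]
    [CommRing R] (f : G → R) (g : G) :
    rightTranslationMatrix R g * convMatrix f = Matrix.of fun x y => f (x * g * y⁻¹) := by
  ext x y
  simp [convMatrix, rightTranslationMatrix, Matrix.mul_apply]

/-- A class sum of an integral idempotent of the group algebra (up to the scalar `c`, a unit modulo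
the kernel of `φ`) vanishes at each `g` separated from `1` by a linear character trivial modulo the
kernel of `φ`. -/
theorem sum_conj_eq_zero_of_ringHom {G R K : Type*} [Group G] [Fintype G] [CommRing R] [IsDomain R]
    [CharZero R] [Field K] (φ : R →+* K) (e : G → ℤ) (c : ℤ)
    (he : ∀ u, ∑ z, e (u * z⁻¹) * e z = c * e u) (hc : φ c ≠ 0)
    (ψ : G →* R) (hψ : ∀ x, φ (ψ x) = 1) (g : G) (hg : ψ g ≠ 1) :
    ∑ x, e (x * g * x⁻¹) = 0 := by
  classical
  have hconv : ∀ u, ∑ z, (e (u * z⁻¹) : R) * (e z : R) = (c : R) * (e u : R) := fun u => by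
    exact_mod_cast congrArg (Int.cast : ℤ → R) (he u)
  have hconv' : ∀ x y, ∑ z, (e (x * z⁻¹) : R) * (e (z * y⁻¹) : R) = (c : R) * (e (x * y⁻¹) : R) :=
    fun x y => by
      rw [← hconv, ← Equiv.sum_comp (Equiv.mulRight y⁻¹) fun z => (e (x * y⁻¹ * z⁻¹) : R) * (e z : R)]
      refine Finset.sum_congr rfl fun z _ => ?_
      simp [mul_assoc]
  have key := trace_mul_eq_of_idempotent_congr φ (c : R) (convMatrix fun x => (e x : R))
    (convMatrix fun x => ψ x * (e x : R)) (rightTranslationMatrix R g)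
    (by
      ext1 x y
      simpa [convMatrix, Matrix.mul_apply] using hconv' x y)
    (by
      ext1 x y
      simp only [convMatrix, Matrix.mul_apply, Matrix.of_apply, Matrix.smul_apply, smul_eq_mul]
      rw [mul_left_comm, ← hconv', Finset.mul_sum]
      refine Finset.sum_congr rfl fun z _ => ?_
      have : ψ (x * y⁻¹) = ψ (x * z⁻¹) * ψ (z * y⁻¹) := by rw [← map_mul]; simp [mul_assoc]
      rw [this]
      ring)
    (by
      ext1 x y
      simp [convMatrix, hψ])
    hc (by rw [convMatrix_mul_rightTranslationMatrix, rightTranslationMatrix_mul_convMatrix])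
    (by rw [convMatrix_mul_rightTranslationMatrix, rightTranslationMatrix_mul_convMatrix])
  have hψconj : ∀ x, ψ (x * g * x⁻¹) = ψ g := fun x => by
    rw [map_mul, mul_comm, ← map_mul, ← mul_assoc, inv_mul_cancel, one_mul]
  rw [convMatrix_mul_rightTranslationMatrix, convMatrix_mul_rightTranslationMatrix] at key
  simp only [Matrix.trace, Matrix.diag_apply, Matrix.of_apply, hψconj] at key
  rw [← Finset.mul_sum] at key
  have h1 : (1 - ψ g) * ∑ x, (e (x * g * x⁻¹) : R) = 0 := by
    rw [sub_mul, one_mul, sub_eq_zero]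
    exact key
  rcases mul_eq_zero.1 h1 with h | h
  · exact absurd (sub_eq_zero.1 h).symm hg
  · exact_mod_cast h

theorem sum_conj_eq_zero {G : Type*} [Group G] [Fintype G] (e : G → ℤ) (c : ℤ)
    (he : ∀ u, ∑ z, e (u * z⁻¹) * e z = c * e u) (p : ℕ) (hp : p.Prime) (hpc : ¬ (p : ℤ) ∣ c)
    (χ : G →* ℂˣ) (hχ : χ ^ p = 1) (g : G) (hg : χ g ≠ 1) :
    ∑ x, e (x * g * x⁻¹) = 0 := by
  obtain ⟨Q, hQ, hQp⟩ := exists_isMaximal_integralClosure_int_mem_iff_dvd p hp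
  let _ : Field (integralClosure ℤ ℂ ⧸ Q) := Ideal.Quotient.field Q
  have hχp : ∀ x, ((χ x : ℂˣ) : ℂ) ^ p = 1 := fun x => by
    have := DFunLike.congr_fun hχ x
    rw [MonoidHom.pow_apply, MonoidHom.one_apply] at this
    rw [← Units.val_pow_eq_pow_val, this, Units.val_one]
  let ψ : G →* integralClosure ℤ ℂ :=
    { toFun := fun x => ⟨χ x, IsIntegral.of_pow hp.pos (by rw [hχp]; exact isIntegral_one)⟩
      map_one' := Subtype.ext (by simp)
      map_mul' := fun x y => Subtype.ext (by simp) }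
  have hψp : ∀ x, ψ x ^ p = 1 := fun x => Subtype.ext (by simpa [ψ] using hχp x)
  refine sum_conj_eq_zero_of_ringHom (Ideal.Quotient.mk Q) e c he (fun h => hpc ((hQp c).1 h)) ψ
    (fun x => ?_) g fun h => hg (Units.ext ?_)
  · have hp0 : ((p : ℕ) : integralClosure ℤ ℂ ⧸ Q) = 0 := by
      have := (hQp p).2 dvd_rfl
      simpa using this
    have : Fact p.Prime := ⟨hp⟩
    have : CharP (integralClosure ℤ ℂ ⧸ Q) p := (CharP.charP_iff_prime_eq_zero hp).2 hp0
    -- In characteristic `p`, Frobenius makes 1 the only `p`-th root of unity.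
    have h1 : (Ideal.Quotient.mk Q (ψ x) - 1) ^ p = 0 := by
      rw [sub_pow_char, ← map_pow, hψp, map_one, one_pow, sub_self]
    exact sub_eq_zero.1 (eq_zero_of_pow_eq_zero h1)
  · simpa [ψ] using congrArg (Subtype.val : integralClosure ℤ ℂ → ℂ) h

/-! ### Spectral projections of a partial difference set -/

/-- Inverse closure turns the count of quotients into the convolution square of the indicator of
`D`; this is the quadratic equation behind the two eigenvalues. -/
theorem IsRegularPDS.sum_indicator_mul {G : Type*} [Group G] [Fintype G] {D : Set G}
    [DecidableEq G] [DecidablePred (· ∈ D)] {v k lam mu : ℕ}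
    (hD : IsRegularPDS D v k lam mu) (u : G) :
    ∑ z, (if u * z⁻¹ ∈ D then (1 : ℤ) else 0) * (if z ∈ D then 1 else 0) =
      (if u = 1 then (k : ℤ) - mu else 0) + ((lam : ℤ) - mu) * (if u ∈ D then 1 else 0) + mu := by
  have hinv : ∀ x, x⁻¹ ∈ D ↔ x ∈ D := fun x =>
    ⟨fun h => by simpa using hD.inv_mem _ h, hD.inv_mem x⟩
  have hsum : ∑ z, (if u * z⁻¹ ∈ D then (1 : ℤ) else 0) * (if z ∈ D then 1 else 0) =
      ({z | u * z⁻¹ ∈ D ∧ z ∈ D} : Set G).ncard := by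
    simp only [← ite_and, mul_ite, mul_one, mul_zero]
    rw [Set.ncard_eq_toFinset_card']
    simp [and_comm]
  have hpairs : ({z | u * z⁻¹ ∈ D ∧ z ∈ D} : Set G).ncard =
      {q : G × G | q.1 ∈ D ∧ q.2 ∈ D ∧ q.1 * q.2⁻¹ = u}.ncard := by
    refine Set.ncard_congr (fun z _ => (u * z⁻¹, z⁻¹)) ?_ ?_ ?_
    · rintro z ⟨h1, h2⟩
      exact ⟨h1, (hinv z).2 h2, by simp⟩
    · rintro a b - - h
      simpa using congrArg Prod.snd h
    · rintro ⟨x, y⟩ ⟨hx, hy, hxy⟩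
      simp only at hx hy hxy
      refine ⟨y⁻¹, ⟨?_, (hinv y).2 hy⟩, ?_⟩
      · rw [← hxy]; simpa using hx
      · simp [← hxy]
  rw [hsum]
  by_cases hu : u = 1
  · subst hu
    have : ({z | 1 * z⁻¹ ∈ D ∧ z ∈ D} : Set G) = D := by
      ext z
      simp [hinv]
    rw [this, hD.card_set]
    simp [hD.one_notMem]
  · rw [hpairs]
    by_cases hu' : u ∈ D
    · rw [hD.count_mem u hu hu']
      simp [hu, hu']
    · rw [hD.count_notMem u hu hu']
      simp [hu, hu']

/-- The spectral projection for the eigenvalue `t'`, scaled by `w' * (t' - t)`, where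
`k - t = m * w`, `k - t' = m' * w'`. -/
theorem IsRegularPDS.projection_mul_self {G : Type*} [Group G] [Fintype G] {D : Set G}
    [DecidableEq G] [DecidablePred (· ∈ D)] {v k lam mu : ℕ}
    (hD : IsRegularPDS D v k lam mu) {t t' m m' w w' : ℤ} (hadd : t + t' = lam - mu)
    (hmul : t * t' = mu - k) (ht : k - t = m * w) (ht' : k - t' = m' * w') (hv : v = w * w')
    (hmu : mu = m * m') (e : G → ℤ)
    (he : ∀ x, e x = w' * ((if x ∈ D then 1 else 0) - t * (if x = 1 then 1 else 0)) - m) (u : G) :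
    ∑ z, e (u * z⁻¹) * e z = w' * (t' - t) * e u := by
  have hinv : ∀ x, x⁻¹ ∈ D ↔ x ∈ D := fun x =>
    ⟨fun h => by simpa using hD.inv_mem _ h, hD.inv_mem x⟩
  have hk : ∑ z, (if z ∈ D then (1 : ℤ) else 0) = k := by
    rw [← hD.card_set, Set.ncard_eq_toFinset_card']
    simp
  have hk' : ∑ z, (if u * z⁻¹ ∈ D then (1 : ℤ) else 0) = k := by
    rw [← hk, ← Equiv.sum_comp ((Equiv.inv G).trans (Equiv.mulLeft u))
      fun z => if z ∈ D then (1 : ℤ) else 0]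
    simp
  have h1 : ∀ z, u * z⁻¹ = 1 ↔ z = u := fun z => by rw [mul_inv_eq_one, eq_comm]
  have hcard : ∑ _z : G, (1 : ℤ) = v := by
    rw [← hD.card_group]; simp
  have ha := hD.sum_indicator_mul u
  have hb : ∑ z, (if u * z⁻¹ ∈ D then (1 : ℤ) else 0) * (if z = 1 then 1 else 0) =
      if u ∈ D then 1 else 0 := by simp
  have hc : ∑ z, (if u * z⁻¹ = 1 then (1 : ℤ) else 0) * (if z ∈ D then 1 else 0) =
      if u ∈ D then 1 else 0 := by
    simp only [h1, ite_mul, one_mul, zero_mul, Finset.sum_ite_eq',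
      Finset.mem_univ, if_true]
  have hd : ∑ z, (if u * z⁻¹ = 1 then (1 : ℤ) else 0) * (if z = 1 then 1 else 0) =
      if u = 1 then 1 else 0 := by simp
  have hf : ∑ z, (if z = (1 : G) then (1 : ℤ) else 0) = 1 := by simp
  have hf' : ∑ z, (if u * z⁻¹ = 1 then (1 : ℤ) else 0) = 1 := by simp [h1]
  have hexp : ∑ z, e (u * z⁻¹) * e z =
      w' ^ 2 * (∑ z, (if u * z⁻¹ ∈ D then (1 : ℤ) else 0) * (if z ∈ D then 1 else 0))
      - w' ^ 2 * t * (∑ z, (if u * z⁻¹ ∈ D then (1 : ℤ) else 0) * (if z = 1 then 1 else 0))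
      - w' ^ 2 * t * (∑ z, (if u * z⁻¹ = 1 then (1 : ℤ) else 0) * (if z ∈ D then 1 else 0))
      + w' ^ 2 * t ^ 2 * (∑ z, (if u * z⁻¹ = 1 then (1 : ℤ) else 0) * (if z = 1 then 1 else 0))
      - m * w' * (∑ z, (if z ∈ D then (1 : ℤ) else 0))
      - m * w' * (∑ z, (if u * z⁻¹ ∈ D then (1 : ℤ) else 0))
      + m * w' * t * (∑ z, (if z = (1 : G) then (1 : ℤ) else 0))
      + m * w' * t * (∑ z, (if u * z⁻¹ = 1 then (1 : ℤ) else 0))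
      + m ^ 2 * ∑ _z : G, (1 : ℤ) := by
    simp only [Finset.mul_sum, ← Finset.sum_add_distrib, ← Finset.sum_sub_distrib]
    refine Finset.sum_congr rfl fun z _ => ?_
    rw [he, he]
    ring
  rw [hexp, ha, hb, hc, hd, hf, hf', hk, hk', hcard, he]
  have hu : (if u = 1 then (k : ℤ) - mu else 0) = (k - mu) * (if u = 1 then 1 else 0) := by simp
  rw [hu]
  -- With `k`, `lam`, `mu`, `v` and `t'` eliminated, what remains is a polynomial identity in which
  -- the indicator values enter linearly.
  generalize (if u = 1 then (1 : ℤ) else 0) = δ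
  generalize (if u ∈ D then (1 : ℤ) else 0) = a
  have hk2 : (k : ℤ) = t + m * w := by linarith
  have ht2 : t' = t + m * w - m' * w' := by linarith
  have hl : (lam : ℤ) = t + t' + mu := by linarith
  have hkm : (k : ℤ) - mu = - (t * t') := by linarith
  rw [hkm, hl, hv, hk2, hmu, ht2]
  ring

/-- The number of `x` with `x * g * x⁻¹ ∈ D`, for `g` separated from `1` by a linear character of
order `p`. -/
theorem IsRegularPDS.ncard_conj_mem {G : Type*} [Group G] [Finite G] {D : Set G} {v k lam mu : ℕ}
    (hD : IsRegularPDS D v k lam mu) {t t' m m' w w' : ℤ} (hadd : t + t' = lam - mu)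
    (hmul : t * t' = mu - k) (ht : k - t = m * w) (ht' : k - t' = m' * w') (hv : v = w * w')
    (hmu : mu = m * m') {p : ℕ} (hp : p.Prime) (hpw : ¬ (p : ℤ) ∣ w' * (t' - t))
    {χ : G →* ℂˣ} (hχ : χ ^ p = 1) {g : G} (hg : χ g ≠ 1) :
    ({x | x * g * x⁻¹ ∈ D}.ncard : ℤ) = m * w := by
  classical
  have := Fintype.ofFinite G
  let e : G → ℤ := fun x => w' * ((if x ∈ D then 1 else 0) - t * (if x = 1 then 1 else 0)) - m
  have h0 := sum_conj_eq_zero e _ (hD.projection_mul_self hadd hmul ht ht' hv hmu e fun _ => rfl)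
    p hp hpw χ hχ g hg
  have hg1 : g ≠ 1 := by rintro rfl; simp at hg
  have hconj : ∀ x, x * g * x⁻¹ ≠ 1 := fun x h => hg1 (by simpa using h)
  have hw' : w' ≠ 0 := by rintro rfl; simp at hpw
  simp only [e, hconj, if_false, mul_zero, sub_zero] at h0
  rw [Finset.sum_sub_distrib, ← Finset.mul_sum] at h0
  have hcard : ∑ _z : G, m = w * w' * m := by
    rw [← hv, ← hD.card_group]; simp
  have hset : ({x | x * g * x⁻¹ ∈ D}.ncard : ℤ) =
      ∑ x, if x * g * x⁻¹ ∈ D then (1 : ℤ) else 0 := by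
    rw [Set.ncard_eq_toFinset_card']
    simp
  -- The vanishing class sum now reads `w' * count = m * v`, with `v = w * w'`.
  rw [hcard, ← hset] at h0
  refine mul_left_cancel₀ hw' ?_
  linarith

/-! ### Fixed points and Sylow normalizers -/

theorem dvd_ncard_of_pow_eq_one_of_forall_ne {α : Type*} [Finite α] {q : ℕ} (hq : q.Prime)
    {S : Set α} (σ : Equiv.Perm α) (hσ : σ ^ q = 1) (hS : ∀ x, x ∈ S ↔ σ x ∈ S)
    (hfix : ∀ x ∈ S, σ x ≠ x) : q ∣ S.ncard := by
  classical
  have := Fintype.ofFinite α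
  have : Fact q.Prime := ⟨hq⟩
  by_contra h
  rw [← Nat.card_coe_set_eq, Nat.card_eq_fintype_card] at h
  obtain ⟨⟨x, hx⟩, hx'⟩ := Equiv.Perm.exists_fixed_point_of_prime (n := 1)
    (σ := σ.subtypePerm fun x => (hS x).symm) h (by
      rw [pow_one, Equiv.Perm.subtypePerm_pow]
      ext x
      simp [hσ])
  exact hfix x hx (congrArg Subtype.val hx')

/-- Since `x` centralizes `g`, right multiplication by `x` preserves the set, and it has no fixed
points. -/
theorem dvd_ncard_conj_mem {G : Type*} [Group G] [Finite G] (D : Set G) {q : ℕ} (hq : q.Prime)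
    {g x : G} (hx : orderOf x = q) (hgx : x * g = g * x) :
    q ∣ {y | y * g * y⁻¹ ∈ D}.ncard := by
  have hpow : ∀ n : ℕ, Equiv.mulRight x ^ n = Equiv.mulRight (x ^ n) := fun n => by
    ext y; simp
  refine dvd_ncard_of_pow_eq_one_of_forall_ne hq (Equiv.mulRight x) ?_ (fun y => ?_) fun y _ h => ?_
  · rw [hpow, ← hx, pow_orderOf_eq_one]
    ext y; simp
  · have : y * x * g * (y * x)⁻¹ = y * g * y⁻¹ := by
      rw [mul_assoc y, hgx]; group
    simp only [Set.mem_ofPred_eq, Equiv.coe_mulRight, this]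
  · have h1 : x = 1 := by simpa using h
    rw [h1, orderOf_one] at hx
    exact hq.one_lt.ne hx

/-- An element of prime order `q ≠ p` normalizing a Sylow `p`-subgroup centralizes some element of
the subgroup at which a given linear character of order `p` is nontrivial. -/
theorem exists_mem_sylow_commute {G : Type*} [Group G] [Finite G] {p : ℕ} [Fact p.Prime]
    (P : Sylow p G) {A : Type*} [CommGroup A] {χ : G →* A} (hχ : orderOf χ = p)
    {q : ℕ} (hq : q.Prime) (hpq : q ≠ p) {x : G} (hx : orderOf x = q)
    (hxP : x ∈ Subgroup.normalizer (P : Set G)) :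
    ∃ g ∈ P, χ g ≠ 1 ∧ x * g = g * x := by
  have hp : p.Prime := Fact.out
  obtain ⟨g₀, hg₀P, hg₀⟩ : ∃ g ∈ P, χ g ≠ 1 := by
    by_contra! h
    have hle : (P : Subgroup G) ≤ χ.ker := fun g hg => h g hg
    have hχ1 : ∃ g, χ g ≠ 1 := by
      by_contra! h'
      have : χ = 1 := MonoidHom.ext h'
      rw [this, orderOf_one] at hχ
      exact hp.one_lt.ne hχ
    obtain ⟨g, hg⟩ := hχ1
    have hord : orderOf (χ.rangeRestrict g) = p := by
      refine orderOf_eq_prime (Subtype.ext ?_) fun h' => hg (congrArg Subtype.val h')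
      have := DFunLike.congr_fun (hχ ▸ pow_orderOf_eq_one χ : χ ^ p = 1) g
      simpa using this
    -- If χ were trivial on `P`, its kernel would have index prime to `p`, yet its image has an
    -- element of order `p`.
    refine P.not_dvd_index (dvd_trans ?_ (Subgroup.index_dvd_of_le hle))
    rw [Subgroup.index_ker, ← hord]
    exact orderOf_dvd_natCard _
  by_contra! hno
  have hmem : ∀ y, y ∈ P ↔ x * y * x⁻¹ ∈ P := fun y => Subgroup.mem_normalizer_iff.1 hxP y
  have hdvd : q ∣ {y | y ∈ P ∧ χ y = χ g₀}.ncard := by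
    refine dvd_ncard_of_pow_eq_one_of_forall_ne hq (MulAut.conj x).toEquiv ?_ (fun y => ?_)
      fun y hy h => ?_
    · have hpow : ∀ n : ℕ, (MulAut.conj x).toEquiv ^ n = (MulAut.conj (x ^ n)).toEquiv := fun n => by
        induction n with
        | zero => ext y; simp
        | succ n ih => rw [pow_succ, ih]; ext y; simp [pow_succ, mul_assoc]
      rw [hpow, ← hx, pow_orderOf_eq_one]
      ext y; simp
    · simp [← hmem y]
    · refine hno y hy.1 (by rw [hy.2]; exact hg₀) ?_
      have : x * y * x⁻¹ = y := h
      rwa [mul_inv_eq_iff_eq_mul] at this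
  -- This fibre of χ on `P` is a coset of the `p`-group `P ⊓ χ.ker`, so its size is a power of `p`
  -- and a `q`-action on it must fix a point.
  have hcard : {y | y ∈ P ∧ χ y = χ g₀}.ncard = Nat.card ((P : Subgroup G) ⊓ χ.ker : Subgroup G) := by
    rw [← Nat.card_coe_set_eq]
    refine Nat.card_congr ((Equiv.mulRight g₀⁻¹).subtypeEquiv fun y => ?_)
    simp only [Set.mem_ofPred_eq, Equiv.coe_mulRight, Subgroup.mem_inf, MonoidHom.mem_ker, map_mul,
      map_inv, mul_inv_eq_one]
    refine and_congr_left fun _ => ?_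
    exact ((P : Subgroup G).mul_mem_cancel_right ((P : Subgroup G).inv_mem hg₀P)).symm
  obtain ⟨n, hn⟩ := IsPGroup.iff_card.1 (P.2.to_le (inf_le_left (b := χ.ker)))
  rw [hcard, hn] at hdvd
  exact hpq ((Nat.prime_dvd_prime_iff_eq hq hp).1 (hq.dvd_of_dvd_pow hdvd))

/-! ### Hall subgroups of solvable groups -/

/-- The last nontrivial derived subgroup is abelian, so its Sylow subgroups are characteristic in it
and hence normal in `G`. -/
theorem exists_normal_isPGroup_of_isSolvable (G : Type*) [Group G] [Finite G] [Nontrivial G]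
    (hG : Group.IsSolvable G) :
    ∃ (r : ℕ) (M : Subgroup G), r.Prime ∧ M.Normal ∧ IsPGroup r M ∧ M ≠ ⊥ := by
  classical
  have hex : ∃ n, derivedSeries G n = ⊥ := hG.solvable
  obtain ⟨n, hn⟩ : ∃ n, Nat.find hex = n + 1 := by
    refine Nat.exists_eq_succ_of_ne_zero fun h => ?_
    have := Nat.find_spec hex
    rw [h, derivedSeries_zero] at this
    exact top_ne_bot this
  have hbot : ⁅derivedSeries G n, derivedSeries G n⁆ = ⊥ := by
    have := Nat.find_spec hex
    rwa [hn, derivedSeries_succ] at this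
  have hne : derivedSeries G n ≠ ⊥ := Nat.find_min hex (by omega)
  set A := derivedSeries G n with hA
  have hAn : A.Normal := derivedSeries_normal G n
  have hcomm : ∀ a b : A, a * b = b * a := fun a b => by
    have := Subgroup.commutator_eq_bot_iff_le_centralizer.1 hbot a.2
    exact (Subtype.ext (Subgroup.mem_centralizer_iff.1 this b b.2)).symm
  have hA1 : Nat.card A ≠ 1 := fun h => hne (Subgroup.card_eq_one.1 h)
  obtain ⟨r, hr, hrA⟩ := Nat.exists_prime_and_dvd hA1
  have : Fact r.Prime := ⟨hr⟩
  obtain ⟨S⟩ := (inferInstance : Nonempty (Sylow r A))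
  have hS : (S : Subgroup A).Normal := ⟨fun a ha b => by
    rw [hcomm b a, mul_assoc, mul_inv_cancel, mul_one]; exact ha⟩
  have : (S : Subgroup A).Characteristic := S.characteristic_of_normal hS
  refine ⟨r, (S : Subgroup A).map A.subtype, hr, inferInstance, S.2.map _, fun h => ?_⟩
  have h2 : (S : Subgroup A) = ⊥ := by
    rwa [Subgroup.map_eq_bot_iff_of_injective _ A.subtype_injective] at h
  exact S.ne_bot_of_dvd_card hrA h2

/-- Induction through `G ⧸ M` for a normal `r`-subgroup `M`. If `r` divides `a`, the preimage of a
Hall subgroup of the quotient works; otherwise Schur–Zassenhaus supplies a complement to `M` in the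
preimage. -/
theorem exists_subgroup_card_eq_of_isSolvable (N : ℕ) : ∀ (G : Type*) [Group G] [Finite G],
    Group.IsSolvable G → Nat.card G = N → ∀ a b : ℕ, Nat.card G = a * b → a.Coprime b →
    ∃ H : Subgroup G, Nat.card H = a := by
  induction N using Nat.strong_induction_on with
  | _ N ih =>
  intro G _ _ hG hN a b hab hcop
  rcases subsingleton_or_nontrivial G with hs | hnt
  · refine ⟨⊥, ?_⟩
    have : a * b = 1 := by rw [← hab]; exact Nat.card_of_subsingleton (1 : G)
    rw [Subgroup.card_bot, Nat.eq_one_of_mul_eq_one_right this]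
  obtain ⟨r, M, hr, hMn, hM, hMbot⟩ := exists_normal_isPGroup_of_isSolvable G hG
  have : Fact r.Prime := ⟨hr⟩
  obtain ⟨n, hn⟩ := IsPGroup.iff_card.1 hM
  have hM1 : 1 < Nat.card M := by
    have := Subgroup.one_lt_card_iff_ne_bot M
    exact this.2 hMbot
  have hmul : Nat.card (G ⧸ M) * Nat.card M = a * b := by
    rw [← hab]; exact (Subgroup.card_eq_card_quotient_mul_card_subgroup M).symm
  have hMpos : 0 < Nat.card M := by omega
  have hlt : Nat.card (G ⧸ M) < N := by
    rw [← hN, hab, ← hmul]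
    exact lt_mul_of_one_lt_right Nat.card_pos hM1
  have hcard : ∀ H : Subgroup (G ⧸ M),
      Nat.card (H.comap (QuotientGroup.mk' M)) = Nat.card H * Nat.card M := fun H => by
    have h1 := (H.comap (QuotientGroup.mk' M)).card_mul_index
    rw [Subgroup.index_comap_of_surjective _ (QuotientGroup.mk'_surjective M)] at h1
    have h2 := H.card_mul_index
    have h3 : H.index ≠ 0 := Subgroup.index_ne_zero_of_finite
    refine Nat.eq_of_mul_eq_mul_right (Nat.pos_of_ne_zero h3) ?_
    rw [h1, mul_right_comm, h2, hmul, hab]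
  have hsol : Group.IsSolvable (G ⧸ M) := inferInstance
  have hMdvd : Nat.card M ∣ a * b := Dvd.intro_left _ hmul
  have hrM : r ∣ a * b := by
    refine dvd_trans ?_ hMdvd
    rw [hn] at hM1 ⊢
    exact dvd_pow_self r (by rintro rfl; simp at hM1)
  rcases (Nat.Prime.dvd_mul hr).1 hrM with hra | hrb
  · have hrb : r.Coprime b := Nat.Coprime.coprime_dvd_left hra hcop
    have hMa : Nat.card M ∣ a := by
      have hc : (Nat.card M).Coprime b := by rw [hn]; exact hrb.pow_left n
      exact hc.dvd_of_dvd_mul_right hMdvd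
    obtain ⟨a', rfl⟩ := hMa
    obtain ⟨H, hH⟩ := ih _ hlt (G ⧸ M) hsol rfl a' b
      (Nat.eq_of_mul_eq_mul_right hMpos (by rw [hmul]; ring)) hcop.coprime_mul_left
    exact ⟨H.comap (QuotientGroup.mk' M), by rw [hcard, hH, mul_comm]⟩
  · have hra : r.Coprime a := Nat.Coprime.coprime_dvd_left hrb hcop.symm
    have hMa : (Nat.card M).Coprime a := by rw [hn]; exact hra.pow_left n
    have hMb : Nat.card M ∣ b := hMa.dvd_of_dvd_mul_left hMdvd
    obtain ⟨b', rfl⟩ := hMb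
    obtain ⟨H, hH⟩ := ih _ hlt (G ⧸ M) hsol rfl a b'
      (Nat.eq_of_mul_eq_mul_right hMpos (by rw [hmul]; ring))
      (Nat.Coprime.coprime_mul_left_right hcop)
    set L := H.comap (QuotientGroup.mk' M) with hL
    have hLc : Nat.card L = a * Nat.card M := by rw [hcard, hH]
    have hML : M ≤ L := fun x hx => by
      rw [hL, Subgroup.mem_comap, QuotientGroup.mk'_apply, (QuotientGroup.eq_one_iff x).2 hx]
      exact H.one_mem
    have hMLc : Nat.card (M.subgroupOf L) = Nat.card M :=
      Nat.card_congr (Subgroup.subgroupOfEquivOfLe hML).toEquiv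
    have hidx : (M.subgroupOf L).index = a := by
      have := (M.subgroupOf L).card_mul_index
      rw [hMLc, hLc, mul_comm a] at this
      exact Nat.eq_of_mul_eq_mul_left hMpos this
    obtain ⟨K, hK⟩ := Subgroup.exists_right_complement'_of_coprime (N := M.subgroupOf L)
      (by rw [hMLc, hidx]; exact hMa)
    refine ⟨K.map L.subtype, ?_⟩
    rw [Subgroup.card_map_of_injective L.subtype_injective]
    have := hK.card_mul_card
    rw [hMLc, hLc, mul_comm a] at this
    exact Nat.eq_of_mul_eq_mul_left hMpos this

/-! ### Arithmetic of the parameters -/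

theorem IsPDSFactorization.int_relations {v k lam mu : ℕ} {m w : Fin 2 → ℕ}
    (hw : IsPDSFactorization v k lam mu m w) (hmu : 0 < mu) {s : ℕ} (hs0 : s ≠ 0)
    (hs : Real.sqrt (pdsDisc k lam mu) = (s : ℝ)) {α β : Fin 2} (hαβ : α ≠ β) :
    ((k : ℤ) - m α * w α) + (k - m β * w β) = lam - mu ∧
      ((k : ℤ) - m α * w α) * (k - m β * w β) = mu - k ∧
      ((m α : ℤ) * w α - m β * w β) ^ 2 = s ^ 2 ∧ v = w α * w β ∧ mu = m α * m β := by
  have hmi : ∀ i, (m i : ℝ) ≠ 0 := by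
    intro i
    have h := hw.mu_eq
    rw [Nat.cast_ne_zero]
    rintro h0
    fin_cases i <;> simp_all
  have hθ : ∀ i, pdsTheta k lam mu i = (k : ℝ) - m i * w i := fun i => by
    rw [hw.quot_eq i]
    field_simp [hmi i]
    ring
  have hΔ : (s : ℝ) ^ 2 = ((lam : ℝ) - mu) ^ 2 + 4 * ((k : ℝ) - mu) := by
    rw [← hs, Real.sq_sqrt]
    · rfl
    -- A negative discriminant would have `Real.sqrt` equal to the default 0, against `s ≠ 0`.
    · by_contra h
      rw [Real.sqrt_eq_zero_of_nonpos (le_of_lt (not_le.1 h))] at hs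
      exact hs0 (by exact_mod_cast hs.symm)
  have h0 := hθ 0
  have h1 := hθ 1
  simp only [pdsTheta, Matrix.cons_val_zero, Matrix.cons_val_one, hs] at h0 h1
  have e1 : ((k : ℤ) - m 0 * w 0) + (k - m 1 * w 1) = lam - mu := by
    have : ((k : ℝ) - m 0 * w 0) + (k - m 1 * w 1) = lam - mu := by
      rw [← h0, ← h1]; ring
    exact_mod_cast this
  have e2 : ((k : ℤ) - m 0 * w 0) * (k - m 1 * w 1) = mu - k := by
    have : ((k : ℝ) - m 0 * w 0) * (k - m 1 * w 1) = mu - k := by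
      rw [← h0, ← h1]; linear_combination -hΔ / 4
    exact_mod_cast this
  have e3 : ((m 0 : ℤ) * w 0 - m 1 * w 1) ^ 2 = s ^ 2 := by
    have : ((m 0 : ℝ) * w 0 - m 1 * w 1) ^ 2 = s ^ 2 := by
      have h2 : (m 0 : ℝ) * w 0 - m 1 * w 1 = -s := by linear_combination h0 - h1
      rw [h2]; ring
    exact_mod_cast this
  have hcases : (α = 0 ∧ β = 1) ∨ (α = 1 ∧ β = 0) := by omega
  rcases hcases with ⟨rfl, rfl⟩ | ⟨rfl, rfl⟩
  · exact ⟨e1, e2, e3, hw.v_eq, hw.mu_eq⟩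
  · refine ⟨by rw [add_comm]; exact e1, by rw [mul_comm]; exact e2, by rw [← e3]; ring,
      by rw [mul_comm]; exact hw.v_eq, by rw [mul_comm]; exact hw.mu_eq⟩

theorem IsPDSFactorization.not_dvd_of_dvd {v k lam mu : ℕ} {m w : Fin 2 → ℕ}
    (hw : IsPDSFactorization v k lam mu m w) (hmu : 0 < mu) {s : ℕ} (hs0 : s ≠ 0)
    (hs : Real.sqrt (pdsDisc k lam mu) = (s : ℝ)) {α β : Fin 2} (hαβ : α ≠ β) {q : ℕ}
    (hq : q.Prime) (hqs : ¬ q ∣ s) (hα : q ∣ m α * w α) : ¬ q ∣ m β * w β := by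
  obtain ⟨-, -, h, -, -⟩ := hw.int_relations hmu hs0 hs hαβ
  intro hβ
  have h1 : (q : ℤ) ∣ (m α : ℤ) * w α - m β * w β :=
    dvd_sub (by exact_mod_cast hα) (by exact_mod_cast hβ)
  have h2 : (q : ℤ) ∣ (s : ℤ) ^ 2 := h ▸ dvd_pow h1 two_ne_zero
  exact hqs (hq.dvd_of_dvd_pow (by exact_mod_cast h2))

theorem dvd_and_not_dvd_of_dvd_coprimePart {s n q : ℕ} (hn : n ≠ 0) (hq : q.Prime)
    (h : q ∣ coprimePart s n) : q ∣ n ∧ ¬ q ∣ s := by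
  obtain ⟨⟨h1, h2⟩, -⟩ := isGreatest_coprimePart s n hn
  exact ⟨h.trans h1, fun hqs => hq.one_lt.ne' (Nat.dvd_one.1 (h2 ▸ Nat.dvd_gcd hqs h))⟩

/-- A prime shared with the cofactor could be multiplied in, contradicting maximality. -/
theorem coprime_coprimePart_of_eq_mul {s n r : ℕ} (hn : n ≠ 0) (hr : n = coprimePart s n * r) :
    (coprimePart s n).Coprime r := by
  refine Nat.Coprime.symm (Nat.coprime_of_dvd fun q hq hqr hqc => ?_)
  obtain ⟨⟨h1, h2⟩, hmax⟩ := isGreatest_coprimePart s n hn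
  have hqs := (dvd_and_not_dvd_of_dvd_coprimePart hn hq hqc).2
  have hpos : 0 < coprimePart s n := Nat.pos_of_dvd_of_pos h1 (Nat.pos_of_ne_zero hn)
  have hle := hmax (a := coprimePart s n * q)
    ⟨by conv_rhs => rw [hr]
        exact mul_dvd_mul_left _ hqr,
      Nat.Coprime.mul_right h2 ((hq.coprime_iff_not_dvd.2 hqs).symm)⟩
  exact absurd hle (not_le.2 (lt_mul_of_one_lt_right hpos hq.one_lt))

/-! ### Normalizers and the congruence -/

theorem IsRegularPDS.gcd_card_normalizer_coprimePart {G : Type*} [Group G] [Finite G] {D : Set G}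
    {v k lam mu : ℕ} (hD : IsRegularPDS D v k lam mu) (hmu : 0 < mu)
    {s : ℕ} (hs : Real.sqrt (pdsDisc k lam mu) = (s : ℝ))
    {m w : Fin 2 → ℕ} (hw : IsPDSFactorization v k lam mu m w) {α β : Fin 2} (hαβ : α ≠ β)
    {p : ℕ} (hp : p.Prime) (hps : ¬ p ∣ s) (hpα : p ∣ w α) (hpL : p ∣ Nat.card (G →* ℂˣ))
    (P : Sylow p G) :
    Nat.gcd (Nat.card (Subgroup.normalizer (P : Set G))) (coprimePart s (w β)) = 1 := by
  have : Fact p.Prime := ⟨hp⟩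
  have hs0 : s ≠ 0 := by rintro rfl; simp at hps
  obtain ⟨hadd, hmul, -, hv, hm⟩ := hw.int_relations hmu hs0 hs hαβ
  have hv0 : v ≠ 0 := by rw [← hD.card_group]; exact Nat.card_pos.ne'
  have hwβ : w β ≠ 0 := by rintro h; simp [h] at hv; exact hv0 hv
  obtain ⟨χ, hχ⟩ := exists_prime_orderOf_dvd_card' (G := G →* ℂˣ) p hpL
  by_contra hne
  obtain ⟨q, hq, hqd⟩ := Nat.exists_prime_and_dvd hne
  obtain ⟨hqβ, hqs⟩ := dvd_and_not_dvd_of_dvd_coprimePart hwβ hq (hqd.trans (Nat.gcd_dvd_right _ _))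
  have hpβ := hw.not_dvd_of_dvd hmu hs0 hs hαβ hp hps (hpα.mul_left _)
  have hpq : q ≠ p := by
    rintro rfl
    exact hpβ (hqβ.mul_left _)
  have : Fact q.Prime := ⟨hq⟩
  obtain ⟨⟨x, hxP⟩, hx⟩ := exists_prime_orderOf_dvd_card' q (hqd.trans (Nat.gcd_dvd_left _ _))
  rw [Subgroup.orderOf_mk] at hx
  obtain ⟨g, -, hg, hxg⟩ := exists_mem_sylow_commute P hχ hq hpq hx hxP
  -- The scalar of the projection is a unit modulo `p`: its second factor is m_α w_α - m_β w_β, and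
  -- `p` divides only the first of these products.
  have hpw : ¬ (p : ℤ) ∣ w β * (((k : ℤ) - m β * w β) - (k - m α * w α)) := by
    intro h
    rcases (Nat.prime_iff_prime_int.1 hp).dvd_or_dvd h with h | h
    · exact hpβ (Dvd.dvd.mul_left (by exact_mod_cast h) _)
    · have h2 : (p : ℤ) ∣ m α * w α := by exact_mod_cast hpα.mul_left (m α)
      have h3 : (p : ℤ) ∣ m β * w β := by
        have := dvd_sub h2 h
        rwa [show (m α : ℤ) * w α - (((k : ℤ) - m β * w β) - (k - m α * w α)) = m β * w β by
          ring] at this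
      exact hpβ (by exact_mod_cast h3)
  have hcount := hD.ncard_conj_mem (m := m α) (w := w α) (m' := m β) (w' := w β) hadd hmul
    (by ring) (by ring) (by exact_mod_cast hv) (by exact_mod_cast hm) hp hpw
    (by rw [← hχ]; exact pow_orderOf_eq_one χ) hg
  have hqα : q ∣ m α * w α := by
    have h1 : {y | y * g * y⁻¹ ∈ D}.ncard = m α * w α := by exact_mod_cast hcount
    rw [← h1]
    exact dvd_ncard_conj_mem D hq hx hxg
  exact hw.not_dvd_of_dvd hmu hs0 hs hαβ hq hqs hqα (hqβ.mul_left _)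

/-- In a solvable group, if no Sylow `p`-normalizer meets the Hall divisor `n` of the group order,
then `n ≡ 1` modulo `p`. -/
theorem modEq_one_of_forall_coprime_card_normalizer {G : Type*} [Group G] [Finite G]
    (hG : Group.IsSolvable G) {p : ℕ} [Fact p.Prime] {n r : ℕ} (hn : Nat.card G = n * r)
    (hnr : n.Coprime r) (hpn : ¬ p ∣ n)
    (hP : ∀ P : Sylow p G, (Nat.card (Subgroup.normalizer (P : Set G))).Coprime n) :
    n ≡ 1 [MOD p] := by
  have hp : p.Prime := Fact.out
  obtain ⟨P⟩ := (inferInstance : Nonempty (Sylow p G))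
  set f := (Nat.card G).factorization p with hf
  have hPc : Nat.card P = p ^ f := P.card_eq_multiplicity
  have hcop : (p ^ f).Coprime n := ((hp.coprime_iff_not_dvd).2 hpn).pow_left f
  have hmulP := (P : Subgroup G).card_mul_index
  have hdvd : n ∣ (P : Subgroup G).index := by
    refine hcop.symm.dvd_of_dvd_mul_left ?_
    rw [← hPc, hmulP, hn]
    exact dvd_mul_right n r
  obtain ⟨r', hr'⟩ := hdvd
  have hn0 : 0 < n := Nat.pos_of_ne_zero fun h => by
    rw [h, zero_mul] at hn
    exact Nat.card_pos.ne' hn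
  have hcard : Nat.card G = (p ^ f * n) * r' := by rw [← hmulP, hPc, hr', mul_assoc]
  have hrr' : r' ∣ r := by
    refine ⟨p ^ f, Nat.eq_of_mul_eq_mul_left hn0 ?_⟩
    rw [← hn, hcard]; ring
  have hpr' : ¬ p ∣ r' := fun h => P.not_dvd_index (by rw [hr']; exact h.mul_left n)
  obtain ⟨H, hH⟩ := exists_subgroup_card_eq_of_isSolvable _ G hG rfl (p ^ f * n) r' hcard
    (Nat.Coprime.mul_left (((hp.coprime_iff_not_dvd).2 hpr').pow_left f)
      (hnr.coprime_dvd_right hrr'))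
  obtain ⟨Q⟩ := (inferInstance : Nonempty (Sylow p H))
  have hQc : Nat.card Q = p ^ f := by
    rw [Q.card_eq_multiplicity, hH, Nat.factorization_mul (pow_pos hp.pos f).ne' hn0.ne']
    simp [hp.factorization_self, Nat.factorization_eq_zero_of_not_dvd hpn]
  -- `H` has the full `p`-part of `|G|`, so its Sylow `p`-subgroups are Sylow in `G` and the
  -- hypothesis on normalizers applies.
  let P' : Sylow p G := Sylow.ofCard ((Q : Subgroup H).map H.subtype) (by
    rw [Subgroup.card_map_of_injective H.subtype_injective]; exact hQc)
  have hle : (Subgroup.normalizer (Q : Set H)).map H.subtype ≤ Subgroup.normalizer (P' : Set G) :=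
    Subgroup.le_normalizer_map H.subtype
  set N := Subgroup.normalizer (Q : Set H) with hN
  have hNcop : (Nat.card N).Coprime n := by
    refine Nat.Coprime.coprime_dvd_left ?_ (hP P')
    rw [← Subgroup.card_map_of_injective H.subtype_injective]
    exact Subgroup.card_dvd_of_le hle
  have hNmul := N.card_mul_index
  have hNc : Nat.card N = p ^ f := by
    refine Nat.dvd_antisymm (hNcop.dvd_of_dvd_mul_right ?_) ?_
    · rw [← hH]; exact N.card_subgroup_dvd_card
    · rw [← hQc]; exact Subgroup.card_dvd_of_le Subgroup.le_normalizer
  have hidx : N.index = n := by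
    rw [hNc, hH] at hNmul
    exact Nat.eq_of_mul_eq_mul_left (pow_pos hp.pos f) hNmul
  rw [← hidx, hN, ← Q.card_eq_index_normalizer]
  exact card_sylow_modEq_one p H

theorem theorem3p13 {G : Type*} [Group G] [Finite G] (D : Set G) (v k lam mu : ℕ)
    (hD : IsRegularPDS D v k lam mu) (hmu : 0 < mu)
    (s : ℕ) (hs : Real.sqrt (pdsDisc k lam mu) = (s : ℝ))
    (m w : Fin 2 → ℕ) (hw : IsPDSFactorization v k lam mu m w)
    (α β : Fin 2) (hαβ : α ≠ β)
    (p : ℕ) (hp : p.Prime) (hpG : p ∣ Nat.card G) (hps : ¬ p ∣ s)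
    (hpα : p ∈ (coprimePart s (w α)).primeFactors)
    (hpL : p ∣ Nat.card (G →* ℂˣ))
    (P : Sylow p G) :
    Nat.gcd (Nat.card (Subgroup.normalizer (P : Set G))) (coprimePart s (w β)) = 1 ∧
      (Group.IsSolvable G → coprimePart s (w β) ≡ 1 [MOD p]) := by
  have : Fact p.Prime := ⟨hp⟩
  have hs0 : s ≠ 0 := by rintro rfl; simp at hps
  obtain ⟨-, -, -, hv, -⟩ := hw.int_relations hmu hs0 hs hαβ
  have hv0 : w α * w β ≠ 0 := by rw [← hv, ← hD.card_group]; exact Nat.card_pos.ne'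
  have hwα : w α ≠ 0 := left_ne_zero_of_mul hv0
  have hwβ : w β ≠ 0 := right_ne_zero_of_mul hv0
  have hpwα : p ∣ w α :=
    (dvd_and_not_dvd_of_dvd_coprimePart hwα hp (Nat.dvd_of_mem_primeFactors hpα)).1
  have hgcd := fun P : Sylow p G =>
    hD.gcd_card_normalizer_coprimePart hmu hs hw hαβ hp hps hpwα hpL P
  refine ⟨hgcd P, fun hG => ?_⟩
  obtain ⟨r, hr⟩ := (isGreatest_coprimePart s (w β) hwβ).1.1
  have hnot : ∀ q : ℕ, q.Prime → q ∣ w α → ¬ q ∣ coprimePart s (w β) := fun q hq h1 h2 => by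
    obtain ⟨h3, h4⟩ := dvd_and_not_dvd_of_dvd_coprimePart hwβ hq h2
    exact hw.not_dvd_of_dvd hmu hs0 hs hαβ hq h4 (h1.mul_left _) (h3.mul_left _)
  -- The Hall cofactor of π_β in `v` is `w α` times the rest of `w β`; a prime common to π_β and `w
  -- α` would divide `s`.
  refine modEq_one_of_forall_coprime_card_normalizer hG (r := w α * r) ?_ ?_ (hnot p hp hpwα) hgcd
  · rw [hD.card_group, hv]
    conv_lhs => rw [hr]
    ring
  · exact Nat.Coprime.mul_right
      (Nat.Coprime.symm (Nat.coprime_of_dvd hnot))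
      (coprime_coprimePart_of_eq_mul hwβ hr)
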